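/- Let $p\in[0,1]$, and let the outcomes of coups $1,2,3,\dots$ be independent, each being a win with probability $p$ and a loss with probability $1-p$. In the Labouchère system one starts from a non-empty finite list $L_0$ of positive real numbers. As long as the list $L_{n-1}$ is non-empty, the bet $B_n$ at the $n$-th coup is the sum of the first and last numbers of $L_{n-1}$ (or the single number, if $L_{n-1}$ has only one entry); after a win, $L_n$ is obtained from $L_{n-1}$ by cancelling the first and last terms (the only term, if there is just one), and after a loss, $L_n$ is obtained from $L_{n-1}$ by appending $B_n$ at the end. Let $N\in\{1,2,\dots\}\cup\{\infty\}$ be the first $n$ with $L_n=\varnothing$ ($N=\infty$ if there is none), and let $B^\star=\sup\{B_n: n\ge 1,\ n\le N\}\in[0,\infty]$ be the largest bet. Then, for every such initial list $L_0$, $\mathbb{E}[B^\star]<\infty$ if $p>\frac12$, and $\mathbb{E}[B^\star]=\infty$ if $p<\frac12$. -/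

import Mathlib

open MeasureTheory ProbabilityTheory
open scoped ENNReal

noncomputable section

namespace Labouchere

/-- The bet that the current list prescribes: the sum of the first and the last number, or the
single number if only one remains.  No bet is made (size `0`) once the list is empty. -/
def betSize : List ℝ → ℝ
  | [] => 0
  | [a] => a
  | a :: b :: t => a + (b :: t).getLast (List.cons_ne_nil b t)

/-- One coup.  An empty list stays empty.  After a win (`true`) the first and the last term are
cancelled (a single term is just cancelled); after a loss (`false`) the amount just lost is
appended at the end of the list. -/
def step : List ℝ → Bool → List ℝ
  | [], _ => []
  | a :: t, true => (a :: t).tail.dropLast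
  | a :: t, false => (a :: t) ++ [betSize (a :: t)]

/-- The list after the `n`-th coup, from the initial list `L₀`; the outcome of the `(n+1)`-st
coup is `w n`. -/
def list (L₀ : List ℝ) (w : ℕ → Bool) : ℕ → List ℝ
  | 0 => L₀
  | n + 1 => step (list L₀ w n) (w n)

/-- The bet at the `n`-th coup, for `n ≥ 1`: it is prescribed by the list after coup `n - 1`. -/
def bet (L₀ : List ℝ) (w : ℕ → Bool) (n : ℕ) : ℝ :=
  betSize (list L₀ w (n - 1))

/-- The time at which the list first becomes empty (`⊤` if it never does). -/
def stopTime (L₀ : List ℝ) (w : ℕ → Bool) : ℕ∞ :=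
  ⨅ (n : ℕ) (_ : list L₀ w n = []), (n : ℕ∞)

/-- The largest bet, that is, the supremum in `[0, ∞]` of the bets at the coups `n` with
`1 ≤ n ≤ N`, where `N` is the time at which the list first becomes empty. -/
def maxBet (L₀ : List ℝ) (w : ℕ → Bool) : ℝ≥0∞ :=
  ⨆ (n : ℕ) (_ : 1 ≤ n ∧ (n : ℕ∞) ≤ stopTime L₀ w), ENNReal.ofReal (bet L₀ w n)

end Labouchere

end

/-! Let `S` be the sum of the list and `B` the bet: a win sends `S` to `S - B`, a loss to `S + B`.
If `p > 1/2`, `S` loses `(2p - 1) B` on average, so even the sum of all bets has finite mean.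

If `p < 1/2`, suppose the largest bet `M` has finite mean. In each of two ranges a function `V` of
the list is a submartingale, is dominated by an integrable variable built from `M`, and play ends
almost surely. Dominated convergence gives `V L₀ ≤ V []` (`le_of_dominated`), which is false.

For `p ≤ 1/3`, the length (-2 or +1 away from the boundary) has nonnegative drift, and `V` is the
length plus `2 ^ (-length)`. Domination holds because entries grow at least linearly with their
position, so the length is at most affine in the current bet (`exists_length_le`). The strict drift
of `V` forces play to end.

For `1/3 < p < 1/2`, a power `θ ^ length` with `θ > 1` decreases geometrically on average, so play
ends and powers of the length are under control. Here `V = S ^ α` with `(1 - p) 2 ^ α = 1`;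
domination follows from `S ≤ length * (M + sum of L₀)` and Young's inequality. -/

namespace Labouchere

/-! ### Pathwise properties of the list -/

lemma step_nil (b : Bool) : step [] b = [] := by cases b <;> rfl

lemma list_congr (L₀ : List ℝ) {w w' : ℕ → Bool} {n : ℕ} (h : ∀ i < n, w i = w' i) :
    list L₀ w n = list L₀ w' n := by
  induction n with
  | zero => rfl
  | succ n ih => simp only [list, ih fun i hi => h i (by omega), h n (by omega)]

lemma list_eq_nil_of_le {L₀ : List ℝ} {w : ℕ → Bool} {m n : ℕ} (hmn : m ≤ n)
    (h : list L₀ w m = []) : list L₀ w n = [] := by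
  induction n, hmn using Nat.le_induction with
  | base => exact h
  | succ n _ ih => simp only [list, ih, step_nil]

lemma betSize_eq {L : List ℝ} (hL : 2 ≤ L.length) :
    ∃ a b, ∃ t : List ℝ, L = a :: (t ++ [b]) ∧ betSize L = a + b := by
  match L, hL with
  | a :: b :: t, _ =>
    refine ⟨a, (b :: t).getLast (List.cons_ne_nil b t), (b :: t).dropLast, ?_, rfl⟩
    rw [List.dropLast_append_getLast]

/-- Case analysis on a non-empty list according to how it is played. -/
lemma cases_of_ne_nil {L : List ℝ} (hL : L ≠ []) :
    (∃ a, L = [a] ∧ betSize L = a ∧ step L true = [] ∧ step L false = [a, a]) ∨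
    ∃ a b, ∃ t : List ℝ, L = a :: (t ++ [b]) ∧ betSize L = a + b ∧ step L true = t ∧
      step L false = a :: (t ++ [b, a + b]) := by
  match L, hL with
  | [a], _ => exact Or.inl ⟨a, rfl, rfl, rfl, rfl⟩
  | a :: b :: t, _ =>
    right
    obtain ⟨a', b', t', h, hb⟩ := betSize_eq (L := a :: b :: t) (by simp)
    refine ⟨a', b', t', h, hb, ?_, ?_⟩
    · rw [h]; simp [step]
    · change (a :: b :: t) ++ [betSize (a :: b :: t)] = _
      rw [hb, h]; simp

lemma step_pos {L : List ℝ} (hL : ∀ a ∈ L, 0 < a) (o : Bool) : ∀ a ∈ step L o, 0 < a := by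
  rcases eq_or_ne L [] with rfl | hne
  · simp [step_nil]
  rcases cases_of_ne_nil hne with ⟨a, rfl, -, h1, h2⟩ | ⟨a, b, t, rfl, -, h1, h2⟩
  · cases o <;> simp_all
  · cases o
    · rw [h2]
      have ha : 0 < a := hL a (by simp)
      have hb : 0 < b := hL b (by simp)
      intro x hx
      simp only [List.mem_cons, List.mem_append, List.not_mem_nil, or_false] at hx
      rcases hx with rfl | hx | rfl | rfl
      · exact ha
      · exact hL x (by simp [hx])
      · exact hb
      · exact add_pos ha hb
    · rw [h1]; intro x hx; exact hL x (by simp [hx])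

lemma list_pos {L₀ : List ℝ} (hpos : ∀ a ∈ L₀, 0 < a) (w : ℕ → Bool) (n : ℕ) :
    ∀ a ∈ list L₀ w n, 0 < a := by
  induction n with
  | zero => exact hpos
  | succ n ih => exact step_pos ih _

lemma betSize_nonneg {L : List ℝ} (hL : ∀ a ∈ L, 0 < a) : 0 ≤ betSize L := by
  rcases eq_or_ne L [] with rfl | hne
  · exact le_rfl
  rcases cases_of_ne_nil hne with ⟨a, rfl, h, -, -⟩ | ⟨a, b, t, rfl, h, -, -⟩
  · rw [h]; exact (hL a (by simp)).le
  · rw [h]; exact (add_pos (hL a (by simp)) (hL b (by simp))).le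

lemma sum_nonneg_of_pos {L : List ℝ} (hL : ∀ a ∈ L, 0 < a) : 0 ≤ L.sum :=
  List.sum_nonneg fun a ha => (hL a ha).le

lemma sum_step_true (L : List ℝ) : (step L true).sum = L.sum - betSize L := by
  rcases eq_or_ne L [] with rfl | hne
  · simp [step, betSize]
  rcases cases_of_ne_nil hne with ⟨a, rfl, h, h1, -⟩ | ⟨a, b, t, rfl, h, h1, -⟩
  · simp [h, h1]
  · rw [h, h1]; simp

lemma sum_step_false (L : List ℝ) : (step L false).sum = L.sum + betSize L := by
  match L with
  | [] => simp [step, betSize]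
  | a :: t => simp [step, add_assoc]

lemma betSize_le_sum {L : List ℝ} (hL : ∀ a ∈ L, 0 < a) : betSize L ≤ L.sum := by
  have h := sum_nonneg_of_pos (step_pos hL true)
  rw [sum_step_true] at h
  linarith

/-- The cutoff at the stopping time can be dropped because an empty list bets `0`. -/
lemma maxBet_eq_iSup (L₀ : List ℝ) (w : ℕ → Bool) :
    maxBet L₀ w = ⨆ n, ENNReal.ofReal (betSize (list L₀ w n)) := by
  apply le_antisymm
  · exact iSup₂_le fun n _ =>
      le_iSup (fun n => ENNReal.ofReal (betSize (list L₀ w n))) (n - 1)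
  · refine iSup_le fun n => ?_
    by_cases h : list L₀ w n = []
    · simp [h, betSize]
    · refine le_iSup₂_of_le (n + 1) ⟨by omega, ?_⟩ le_rfl
      refine le_iInf₂ fun m hm => ?_
      rw [Nat.cast_le]
      by_contra hlt
      exact h (list_eq_nil_of_le (by omega) hm)

lemma betSize_le_maxBet (L₀ : List ℝ) (w : ℕ → Bool) (n : ℕ) :
    ENNReal.ofReal (betSize (list L₀ w n)) ≤ maxBet L₀ w := by
  rw [maxBet_eq_iSup]
  exact le_iSup (fun n => ENNReal.ofReal (betSize (list L₀ w n))) n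

/-- Every entry is either an initial one or a bet made earlier. -/
lemma mem_list_le (L₀ : List ℝ) (hpos : ∀ a ∈ L₀, 0 < a) (w : ℕ → Bool) (n : ℕ) :
    ∀ a ∈ list L₀ w n, ENNReal.ofReal a ≤ maxBet L₀ w + ENNReal.ofReal L₀.sum := by
  induction n with
  | zero =>
    intro a ha
    refine le_add_left (ENNReal.ofReal_le_ofReal ?_)
    exact List.single_le_sum (fun x hx => (hpos x hx).le) a ha
  | succ n ih =>
    intro a ha
    have hB := betSize_le_maxBet L₀ w n
    simp only [list] at ha
    generalize hL : list L₀ w n = L at *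
    match L, w n, ha with
    | [], o, ha => simp [step_nil] at ha
    | x :: t, true, ha =>
      exact ih a (List.mem_of_mem_tail (List.mem_of_mem_dropLast ha))
    | x :: t, false, ha =>
      simp only [step, List.mem_append, List.mem_singleton] at ha
      rcases ha with ha | rfl
      · exact ih a ha
      · exact hB.trans le_self_add

lemma ofReal_sum_le_length_mul {L : List ℝ} {M : ℝ≥0∞} (h : ∀ a ∈ L, ENNReal.ofReal a ≤ M) :
    ENNReal.ofReal L.sum ≤ L.length * M := by
  induction L with
  | nil => simp
  | cons a t ih =>
    simp only [List.sum_cons, List.length_cons, Nat.cast_add, Nat.cast_one, add_mul, one_mul]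
    rw [add_comm _ M]
    exact ENNReal.ofReal_add_le.trans
      (add_le_add (h a (by simp)) (ih fun b hb => h b (by simp [hb])))

/-- A win moves each surviving entry one place to the left, which only helps the bound. A loss
appends first plus last, which exceeds the last by at least `δ`; for a single entry `1 ≤ k` makes
the bound at most `δ`. -/
lemma step_getElem_ge {δ : ℝ} {k : ℕ} (hδ : 0 < δ) (hk : 1 ≤ k) {L : List ℝ}
    (h : ∀ a ∈ L, δ ≤ a) (hL : ∀ i (hi : i < L.length), δ * (i + 1 - k) ≤ L[i]) (o : Bool) :
    (∀ a ∈ step L o, δ ≤ a) ∧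
      ∀ i (hi : i < (step L o).length), δ * (i + 1 - k) ≤ (step L o)[i] := by
  have hk' : (1 : ℝ) ≤ k := by exact_mod_cast hk
  match L, o with
  | [], o => simp [step_nil]
  | x :: t, true =>
    refine ⟨fun a ha => h a (List.mem_of_mem_tail (List.mem_of_mem_dropLast ha)), ?_⟩
    intro i hi
    simp only [step, List.tail_cons, List.length_dropLast] at hi
    have := hL (i + 1) (by simp; omega)
    simp only [step, List.tail_cons, List.getElem_dropLast]
    simp only [List.getElem_cons_succ] at this
    push_cast at this
    nlinarith
  | x :: t, false =>
    have hx : δ ≤ x := h x (by simp)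
    have hb : δ ≤ betSize (x :: t) ∧ δ * ((t.length : ℝ) + 1 + 1 - k) ≤ betSize (x :: t) := by
      match t with
      | [] =>
        refine ⟨hx, ?_⟩
        simp only [betSize, List.length_nil, Nat.cast_zero]
        nlinarith
      | y :: s =>
        have h1 := hL (s.length + 1) (by simp)
        have h2 : (y :: s).getLast (List.cons_ne_nil y s) = (x :: y :: s)[s.length + 1] := by
          simp [List.getLast_eq_getElem]
        have h3 : δ ≤ (y :: s).getLast (List.cons_ne_nil y s) :=
          h _ (List.mem_cons_of_mem _ (List.getLast_mem _))
        simp only [betSize]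
        refine ⟨by linarith, ?_⟩
        rw [← h2] at h1
        push_cast at h1
        simp only [List.length_cons]
        push_cast
        nlinarith
    constructor
    · intro a ha
      simp only [step, List.mem_append, List.mem_singleton] at ha
      rcases ha with ha | rfl
      · exact h a ha
      · exact hb.1
    · intro i hi
      simp only [step, List.length_append, List.length_singleton] at hi
      by_cases hi' : i < (x :: t).length
      · simp only [step]
        rw [List.getElem_append_left hi']
        exact hL i hi'
      · have : i = (x :: t).length := by omega
        subst this
        simp only [step, List.getElem_append_right le_rfl]
        simpa using hb.2

lemma exists_length_le {L₀ : List ℝ} (hL₀ : L₀ ≠ []) (hpos : ∀ a ∈ L₀, 0 < a) :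
    ∃ δ : ℝ, 0 < δ ∧ ∀ (w : ℕ → Bool) (n : ℕ),
      δ * (list L₀ w n).length ≤ δ * L₀.length + betSize (list L₀ w n) := by
  obtain ⟨δ, hδ, hle⟩ : ∃ δ : ℝ, 0 < δ ∧ ∀ a ∈ L₀, δ ≤ a := by
    clear hL₀
    induction L₀ with
    | nil => exact ⟨1, one_pos, by simp⟩
    | cons a t ih =>
      obtain ⟨δ, hδ, h⟩ := ih fun b hb => hpos b (by simp [hb])
      refine ⟨min a δ, lt_min (hpos a (by simp)) hδ, fun b hb => ?_⟩
      rcases List.mem_cons.1 hb with rfl | hb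
      · exact min_le_left _ _
      · exact (min_le_right _ _).trans (h b hb)
  have hk : 1 ≤ L₀.length := List.length_pos_iff.2 hL₀
  refine ⟨δ, hδ, fun w n => ?_⟩
  have key : (∀ a ∈ list L₀ w n, δ ≤ a) ∧
      ∀ i (hi : i < (list L₀ w n).length), δ * (i + 1 - L₀.length) ≤ (list L₀ w n)[i] := by
    induction n with
    | zero =>
      refine ⟨hle, fun i hi => ?_⟩
      have h1 : (i : ℝ) + 1 ≤ L₀.length := by exact_mod_cast hi
      have h2 : δ ≤ L₀[i] := hle _ (List.getElem_mem _)
      change _ ≤ L₀[i]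
      nlinarith
    | succ n ih => exact step_getElem_ge hδ hk ih.1 ih.2 (w n)
  generalize list L₀ w n = L at key
  rcases eq_or_ne L [] with rfl | hne
  · simp [betSize]; positivity
  rcases cases_of_ne_nil hne with ⟨a, rfl, h, -, -⟩ | ⟨a, b, t, rfl, h, -, -⟩
  · rw [h]
    have := key.2 0 (by simp)
    simp at this ⊢
    linarith
  · have h1 := key.2 (t.length + 1) (by simp)
    have h2 := key.1 a (by simp)
    simp at h1
    rw [h]
    simp
    nlinarith

end Labouchere

/-! ### Markov property, drift inequalities and the superfair case -/

namespace Labouchere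

section Play

variable {Ω : Type*} [MeasurableSpace Ω] {μ : Measure Ω} {W : ℕ → Ω → Bool}

/-- Factoring through the finite type `Finset.range n → Bool` makes every function of the list
measurable, with no σ-algebra on `List ℝ`. -/
lemma list_eq_comp (L₀ : List ℝ) (w : ℕ → Bool) (n : ℕ) :
    list L₀ w n =
      list L₀ (fun i => if h : i ∈ Finset.range n then
        (fun j : Finset.range n => w j) ⟨i, h⟩ else false) n :=
  list_congr L₀ fun i hi => by simp [hi]

lemma measurable_comp_list {β : Type*} [MeasurableSpace β] (hW : ∀ n, Measurable (W n))
    (L₀ : List ℝ) (F : List ℝ → β) (n : ℕ) :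
    Measurable fun ω => F (list L₀ (fun i => W i ω) n) := by
  have h : (fun ω => F (list L₀ (fun i => W i ω) n)) =
      (fun x : Finset.range n → Bool => F (list L₀ (fun i => if h : i ∈ Finset.range n then
        x ⟨i, h⟩ else false) n)) ∘ fun ω (j : Finset.range n) => W j ω := by
    funext ω
    exact congrArg F (list_eq_comp L₀ _ n)
  rw [h]
  exact (measurable_of_finite _).comp (measurable_pi_lambda _ fun j => hW j)

lemma lintegral_list_mul (hW : ∀ n, Measurable (W n)) (hind : iIndepFun W μ)
    (L₀ : List ℝ) (F : List ℝ → ℝ≥0∞) (G : Bool → ℝ≥0∞) (n : ℕ) :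
    ∫⁻ ω, F (list L₀ (fun i => W i ω) n) * G (W n ω) ∂μ =
      (∫⁻ ω, F (list L₀ (fun i => W i ω) n) ∂μ) * ∫⁻ ω, G (W n ω) ∂μ := by
  have h := hind.indepFun_finset (Finset.range n) {n} (by simp) hW
  have h2 := h.comp (φ := fun x : Finset.range n → Bool =>
      F (list L₀ (fun i => if h : i ∈ Finset.range n then x ⟨i, h⟩ else false) n))
    (ψ := fun x : ({n} : Finset ℕ) → Bool => G (x ⟨n, by simp⟩))
    (measurable_of_finite _) (measurable_of_finite _)
  have h3 : (fun x : Finset.range n → Bool =>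
      F (list L₀ (fun i => if h : i ∈ Finset.range n then x ⟨i, h⟩ else false) n)) ∘
      (fun ω (j : Finset.range n) => W j ω) = fun ω => F (list L₀ (fun i => W i ω) n) := by
    funext ω
    exact (congrArg F (list_eq_comp L₀ (fun i => W i ω) n)).symm
  rw [h3] at h2
  exact lintegral_mul_eq_lintegral_mul_lintegral_of_indepFun (measurable_comp_list hW L₀ F n)
    ((measurable_of_finite G).comp (hW n)) h2

variable [IsProbabilityMeasure μ] {p : ℝ}

lemma lintegral_list_succ (hp0 : 0 ≤ p)
    (hW : ∀ n, Measurable (W n)) (hind : iIndepFun W μ)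
    (hWp : ∀ n, μ {ω | W n ω = true} = ENNReal.ofReal p)
    (L₀ : List ℝ) (V : List ℝ → ℝ≥0∞) (n : ℕ) :
    ∫⁻ ω, V (list L₀ (fun i => W i ω) (n + 1)) ∂μ =
      ∫⁻ ω, (ENNReal.ofReal p * V (step (list L₀ (fun i => W i ω) n) true) +
        ENNReal.ofReal (1 - p) * V (step (list L₀ (fun i => W i ω) n) false)) ∂μ := by
  have hT : MeasurableSet {ω | W n ω = true} := hW n (measurableSet_singleton true)
  have hF : {ω | W n ω = false} = {ω | W n ω = true}ᶜ := by ext ω; simp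
  have h1 : ∀ b : Bool, ∫⁻ ω, (if W n ω = b then 1 else 0) ∂μ = μ {ω | W n ω = b} := by
    intro b
    rw [← lintegral_indicator_one (measurableSet_eq_fun (hW n) measurable_const)]
    refine lintegral_congr fun ω => ?_
    simp [Set.indicator_apply]
  have hq : μ {ω | W n ω = false} = ENNReal.ofReal (1 - p) := by
    rw [hF, prob_compl_eq_one_sub hT, hWp, ENNReal.ofReal_sub _ hp0, ENNReal.ofReal_one]
  have h2 := fun b => lintegral_list_mul hW hind L₀ (fun L => V (step L b))
    (fun x => if x = b then 1 else 0) n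
  have hm := fun b => measurable_comp_list hW L₀ (fun L => V (step L b)) n
  rw [lintegral_add_left ((hm true).const_mul _), lintegral_const_mul _ (hm true),
    lintegral_const_mul _ (hm false), ← hWp n, ← hq, ← h1, ← h1, mul_comm, ← h2 true,
    mul_comm (∫⁻ ω, _ ∂μ), ← h2 false, ← lintegral_add_left]
  · refine lintegral_congr fun ω => ?_
    simp only [list]
    cases W n ω <;> simp
  · exact (hm true).mul ((measurable_of_finite fun x => if x = true then (1 : ℝ≥0∞) else 0).comp
      (hW n))

/-- A Lyapunov function which decreases on average by at least `c` bounds the total mean of `c`. -/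
lemma tsum_lintegral_le_of_drift (hp1 : p ≤ 1) (hp0 : 0 ≤ p)
    (hW : ∀ n, Measurable (W n)) (hind : iIndepFun W μ)
    (hWp : ∀ n, μ {ω | W n ω = true} = ENNReal.ofReal p)
    {L₀ : List ℝ} (hpos : ∀ a ∈ L₀, 0 < a) {V c : List ℝ → ℝ}
    (hV : ∀ L, (∀ a ∈ L, 0 < a) → 0 ≤ V L) (hc : ∀ L, (∀ a ∈ L, 0 < a) → 0 ≤ c L)
    (h : ∀ L, (∀ a ∈ L, 0 < a) → p * V (step L true) + (1 - p) * V (step L false) + c L ≤ V L) :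
    ∫⁻ ω, ∑' n, ENNReal.ofReal (c (list L₀ (fun i => W i ω) n)) ∂μ ≤ ENNReal.ofReal (V L₀) := by
  have hmc := measurable_comp_list hW L₀ (fun L => ENNReal.ofReal (c L))
  rw [lintegral_tsum fun n => (hmc n).aemeasurable]
  refine ENNReal.tsum_le_of_sum_range_le fun n => ?_
  suffices hs : ∫⁻ ω, ENNReal.ofReal (V (list L₀ (fun i => W i ω) n)) ∂μ +
      ∑ j ∈ Finset.range n, ∫⁻ ω, ENNReal.ofReal (c (list L₀ (fun i => W i ω) j)) ∂μ ≤
      ENNReal.ofReal (V L₀) from le_add_self.trans hs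
  induction n with
  | zero => simp [list]
  | succ n ih =>
    refine le_trans ?_ ih
    rw [Finset.sum_range_succ, add_comm (∑ j ∈ _, _), ← add_assoc,
      lintegral_list_succ hp0 hW hind hWp L₀ (fun L => ENNReal.ofReal (V L)),
      ← lintegral_add_right _ (hmc n)]
    gcongr with ω
    have hL := list_pos hpos (fun i => W i ω) n
    have hT := hV _ (step_pos hL true)
    have hF := hV _ (step_pos hL false)
    rw [← ENNReal.ofReal_mul hp0, ← ENNReal.ofReal_mul (by linarith),
      ← ENNReal.ofReal_add (mul_nonneg hp0 hT) (mul_nonneg (by linarith) hF),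
      ← ENNReal.ofReal_add (add_nonneg (mul_nonneg hp0 hT) (mul_nonneg (by linarith) hF)) (hc _ hL)]
    exact ENNReal.ofReal_le_ofReal (h _ hL)

lemma add_sum_lintegral_le_of_drift (hp1 : p ≤ 1) (hp0 : 0 ≤ p)
    (hW : ∀ n, Measurable (W n)) (hind : iIndepFun W μ)
    (hWp : ∀ n, μ {ω | W n ω = true} = ENNReal.ofReal p)
    {L₀ : List ℝ} (hpos : ∀ a ∈ L₀, 0 < a) {V c : List ℝ → ℝ}
    (hV : ∀ L, (∀ a ∈ L, 0 < a) → 0 ≤ V L) (hc : ∀ L, (∀ a ∈ L, 0 < a) → 0 ≤ c L)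
    (h : ∀ L, (∀ a ∈ L, 0 < a) → V L + c L ≤ p * V (step L true) + (1 - p) * V (step L false))
    (n : ℕ) :
    ENNReal.ofReal (V L₀) +
      ∑ j ∈ Finset.range n, ∫⁻ ω, ENNReal.ofReal (c (list L₀ (fun i => W i ω) j)) ∂μ ≤
      ∫⁻ ω, ENNReal.ofReal (V (list L₀ (fun i => W i ω) n)) ∂μ := by
  have hmc := measurable_comp_list hW L₀ (fun L => ENNReal.ofReal (c L))
  induction n with
  | zero => simp [list]
  | succ n ih =>
    rw [Finset.sum_range_succ, ← add_assoc]
    refine (add_le_add_left ih _).trans ?_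
    rw [lintegral_list_succ hp0 hW hind hWp L₀ (fun L => ENNReal.ofReal (V L)),
      ← lintegral_add_right _ (hmc n)]
    refine lintegral_mono fun ω => ?_
    dsimp only
    have hL := list_pos hpos (fun i => W i ω) n
    have hT := hV _ (step_pos hL true)
    have hF := hV _ (step_pos hL false)
    rw [← ENNReal.ofReal_mul hp0, ← ENNReal.ofReal_mul (by linarith),
      ← ENNReal.ofReal_add (mul_nonneg hp0 hT) (mul_nonneg (by linarith) hF),
      ← ENNReal.ofReal_add (hV _ hL) (hc _ hL)]
    exact ENNReal.ofReal_le_ofReal (h _ hL)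

/-- Optional stopping: once play ends, `V` of the list stays at `V []`, so dominated convergence
applies. -/
lemma le_of_dominated (hW : ∀ n, Measurable (W n)) {L₀ : List ℝ} {V : List ℝ → ℝ}
    {G : Ω → ℝ≥0∞} (hG : ∫⁻ ω, G ω ∂μ ≠ ∞)
    (hle : ∀ n ω, ENNReal.ofReal (V (list L₀ (fun i => W i ω) n)) ≤ G ω)
    (hend : ∀ᵐ ω ∂μ, ∃ n, list L₀ (fun i => W i ω) n = [])
    (hsub : ∀ n, ENNReal.ofReal (V L₀) ≤
      ∫⁻ ω, ENNReal.ofReal (V (list L₀ (fun i => W i ω) n)) ∂μ) :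
    ENNReal.ofReal (V L₀) ≤ ENNReal.ofReal (V []) := by
  have ht := tendsto_lintegral_of_dominated_convergence (μ := μ)
    (F := fun n ω => ENNReal.ofReal (V (list L₀ (fun i => W i ω) n)))
    (f := fun _ => ENNReal.ofReal (V [])) G
    (measurable_comp_list hW L₀ fun L => ENNReal.ofReal (V L))
    (fun n => Filter.Eventually.of_forall (hle n)) hG (by
      filter_upwards [hend] with ω ⟨n, hn⟩
      refine tendsto_const_nhds.congr' ?_
      filter_upwards [Filter.eventually_ge_atTop n] with m hm
      rw [list_eq_nil_of_le hm hn])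
  rw [lintegral_const, measure_univ, mul_one] at ht
  exact ge_of_tendsto' ht hsub

lemma measurable_maxBet (hW : ∀ n, Measurable (W n)) (L₀ : List ℝ) :
    Measurable fun ω => maxBet L₀ (fun n => W n ω) := by
  simp only [maxBet_eq_iSup]
  exact Measurable.iSup (measurable_comp_list hW L₀ fun L => ENNReal.ofReal (betSize L))

/-- In a superfair game the mean of the sum of all bets is finite. -/
theorem lintegral_maxBet_lt_top (hp1 : p ≤ 1) (hp : 1 / 2 < p)
    (hW : ∀ n, Measurable (W n)) (hind : iIndepFun W μ)
    (hWp : ∀ n, μ {ω | W n ω = true} = ENNReal.ofReal p)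
    {L₀ : List ℝ} (hpos : ∀ a ∈ L₀, 0 < a) :
    ∫⁻ ω, maxBet L₀ (fun n => W n ω) ∂μ < ∞ := by
  have h := tsum_lintegral_le_of_drift hp1 (by linarith) hW hind hWp hpos
    (V := fun L => L.sum / (2 * p - 1)) (c := betSize)
    (fun L hL => div_nonneg (sum_nonneg_of_pos hL) (by linarith)) (fun L hL => betSize_nonneg hL)
    (fun L hL => by
      have : (2 * p - 1) ≠ 0 := by linarith
      simp only [sum_step_true, sum_step_false]
      simp only [div_eq_mul_inv]
      exact le_of_eq (by linear_combination -betSize L * mul_inv_cancel₀ this))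
  refine (lintegral_mono fun ω => ?_).trans_lt (h.trans_lt ENNReal.ofReal_lt_top)
  rw [maxBet_eq_iSup]
  exact iSup_le fun n => ENNReal.le_tsum n

end Play

end Labouchere

/-! ### Drift inequalities for the subfair case -/

namespace Labouchere

lemma length_step_true (L : List ℝ) : (step L true).length = L.length - 2 := by
  match L with
  | [] => rfl
  | a :: t => simp [step]

lemma length_step_false {L : List ℝ} (hL : L ≠ []) :
    (step L false).length = L.length + 1 := by
  match L, hL with
  | a :: t, _ => simp [step]

/-- At `p = 1/3` the length alone has zero drift from length 2 on; the convex term `2 ^ (-length)`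
makes the drift strictly positive. -/
lemma length_drift {p : ℝ} (hp : p ≤ 1 / 3) (L : List ℝ) :
    ((L.length : ℝ) + (1 / 2) ^ L.length) + (if L = [] then 0 else (1 / 2) ^ L.length / 2) ≤
      p * ((step L true).length + (1 / 2) ^ (step L true).length) +
        (1 - p) * ((step L false).length + (1 / 2) ^ (step L false).length) := by
  by_cases hne : L = []
  · subst hne; simp [step_nil]
  rw [length_step_true, length_step_false hne, if_neg hne]
  have hlen : L.length ≠ 0 := by simpa using hne
  generalize L.length = l at hlen
  match l, hlen with
  | 1, _ => norm_num; linarith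
  | m + 2, _ =>
    have hu0 : (0 : ℝ) ≤ (1 / 2) ^ m := by positivity
    have hu1 : ((1 : ℝ) / 2) ^ m ≤ 1 := pow_le_one₀ (by norm_num) (by norm_num)
    simp only [Nat.add_sub_cancel, pow_add]
    push_cast
    generalize ((1 : ℝ) / 2) ^ m = u at hu0 hu1
    -- The difference of the sides is `(1 - u)(1 - 3p) + u(3/4 - 17p/8)`.
    nlinarith [mul_nonneg (sub_nonneg.2 hu1) (by linarith : 0 ≤ 1 - 3 * p),
      mul_nonneg hu0 (by linarith : 0 ≤ 3 / 4 - 17 * p / 8)]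

lemma exists_exponential_base {p : ℝ} (hp : 1 / 3 < p) (hp1 : p < 1) :
    ∃ θ ε : ℝ, 1 < θ ∧ 0 < ε ∧ p + (1 - p) * θ ^ 3 + ε * θ ^ 2 = θ ^ 2 := by
  -- `p + (1 - p)θ³ - θ²` vanishes at `θ = 1` with slope `1 - 3p < 0`, so a small step to the right
  -- makes it negative.
  set t := (3 * p - 1) / 4 with ht
  have ht0 : 0 < t := by rw [ht]; linarith
  have ht1 : t < 1 := by rw [ht]; linarith
  have key : p + (1 - p) * (1 + t) ^ 3 < (1 + t) ^ 2 := by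
    have h1 : (1 - 3 * p) + t * (2 - 3 * p) + t ^ 2 * (1 - p) < 0 := by
      have : 3 * p = 4 * t + 1 := by rw [ht]; ring
      nlinarith
    nlinarith [mul_neg_of_pos_of_neg ht0 h1]
  refine ⟨1 + t, ((1 + t) ^ 2 - (p + (1 - p) * (1 + t) ^ 3)) / (1 + t) ^ 2, by linarith, ?_, ?_⟩
  · exact div_pos (by linarith) (by positivity)
  · field_simp; ring

lemma exponential_drift {p θ ε : ℝ} (hp0 : 0 ≤ p) (hθ : 1 < θ)
    (h : p + (1 - p) * θ ^ 3 + ε * θ ^ 2 = θ ^ 2) (L : List ℝ) :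
    p * (if step L true = [] then 0 else θ ^ (step L true).length) +
      (1 - p) * (if step L false = [] then 0 else θ ^ (step L false).length) +
      ε * (if L = [] then 0 else θ ^ L.length) ≤ if L = [] then 0 else θ ^ L.length := by
  by_cases hne : L = []
  · subst hne; simp [step_nil]
  have hf : step L false ≠ [] := by
    rw [← List.length_pos_iff, length_step_false hne]; omega
  rw [if_neg hf, if_neg hne, length_step_false hne]
  have ht : (if step L true = [] then 0 else θ ^ (step L true).length) ≤
      if L.length = 1 then 0 else θ ^ (L.length - 2) := by
    rw [← length_step_true]
    split_ifs with h1 h2 h2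
    · exact le_rfl
    · positivity
    · rw [← List.length_eq_zero_iff, length_step_true] at h1; omega
    · exact le_rfl
  have ht' := mul_le_mul_of_nonneg_left ht hp0
  refine (add_le_add_left (add_le_add_left ht' _) _).trans ?_
  have hlen : L.length ≠ 0 := by simpa using hne
  generalize L.length = l at hlen
  match l, hlen with
  | 1, _ =>
    simp only [if_true, mul_zero, zero_add]
    have : θ * ((1 - p) * θ ^ 2 + ε * θ) ≤ θ * θ := by nlinarith
    simpa using le_of_mul_le_mul_left this (by linarith)
  | m + 2, _ =>
    rw [if_neg (by omega), Nat.add_sub_cancel]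
    apply le_of_eq
    calc _ = θ ^ m * (p + (1 - p) * θ ^ 3 + ε * θ ^ 2) := by ring
      _ = _ := by rw [h]; ring

lemma exists_rpow_exponent {q : ℝ} (hq : 1 / 2 < q) (hq1 : q < 1) :
    ∃ α : ℝ, 0 < α ∧ α < 1 ∧ q * 2 ^ α = 1 := by
  have hq0 : 0 < q := by linarith
  refine ⟨Real.logb 2 q⁻¹, ?_, ?_, ?_⟩
  · exact Real.logb_pos (by norm_num) ((one_lt_inv₀ hq0).2 hq1)
  · rw [Real.logb_lt_iff_lt_rpow (by norm_num) (by positivity), Real.rpow_one]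
    rw [inv_lt_comm₀ hq0 (by norm_num)]
    linarith
  · rw [Real.rpow_logb (by norm_num) (by norm_num) (by positivity), mul_inv_cancel₀ hq0.ne']

/-- Equality holds at `B = 0` and, by the choice of `α`, at `B = S`; the right side is concave in
`B`. -/
lemma rpow_le_mean_rpow {p α S B : ℝ} (hp0 : 0 ≤ p) (hp1 : p ≤ 1) (hα0 : 0 < α) (hα1 : α < 1)
    (hα : (1 - p) * 2 ^ α = 1) (hB : 0 ≤ B) (hBS : B ≤ S) :
    S ^ α ≤ p * (S - B) ^ α + (1 - p) * (S + B) ^ α := by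
  rcases (hB.trans hBS).eq_or_lt with h0 | hS
  · have : B = 0 := by linarith
    subst this
    apply le_of_eq
    simp only [sub_zero, add_zero]
    ring
  obtain ⟨x, rfl⟩ : ∃ x, B = x * S := ⟨B / S, by field_simp⟩
  have hx0 : 0 ≤ x := by by_contra! hx; nlinarith
  have hx1 : x ≤ 1 := by by_contra! hx; nlinarith
  have hc := (Real.concaveOn_rpow hα0.le hα1.le).2
  have h1 : (1 - x) * S ^ α ≤ (S - x * S) ^ α := by
    have := hc (x := S) hS.le (y := 0) (by simp) (sub_nonneg.2 hx1) hx0 (by ring)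
    simp only [smul_eq_mul, mul_zero, add_zero, Real.zero_rpow hα0.ne'] at this
    rwa [show S - x * S = (1 - x) * S by ring]
  have h2 : (1 - x) * S ^ α + x * (2 ^ α * S ^ α) ≤ (S + x * S) ^ α := by
    have := hc (x := S) hS.le (y := 2 * S) (by simp [hS.le]) (sub_nonneg.2 hx1) hx0 (by ring)
    simp only [smul_eq_mul, Real.mul_rpow (by norm_num : (0 : ℝ) ≤ 2) hS.le] at this
    rwa [show S + x * S = (1 - x) * S + x * (2 * S) by ring]
  have h3 := mul_le_mul_of_nonneg_left h1 hp0
  have h4 := mul_le_mul_of_nonneg_left h2 (sub_nonneg.2 hp1)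
  have h5 : (1 - p) * ((1 - x) * S ^ α + x * (2 ^ α * S ^ α)) =
      (1 - p) * ((1 - x) * S ^ α) + x * S ^ α := by
    linear_combination x * S ^ α * hα
  nlinarith

/-- Young's inequality with exponents `1/α` and `1/(1 - α)`, whose coefficients are at most 1. It
keeps `y` to the first power, so only a first moment of the largest bet is needed. -/
lemma mul_rpow_le_add {α : ℝ} (hα0 : 0 < α) (hα1 : α < 1) (x y : ℝ≥0∞) :
    (x * y) ^ α ≤ y + x ^ (α / (1 - α)) := by
  have h1 : 0 < 1 - α := by linarith
  have hc : (1 / α).HolderConjugate (1 / (1 - α)) := by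
    rw [Real.holderConjugate_iff]
    refine ⟨by rw [lt_div_iff₀ hα0]; linarith, by simp⟩
  have h := ENNReal.young_inequality (y ^ α) (x ^ α) hc
  rw [← ENNReal.rpow_mul, ← ENNReal.rpow_mul, mul_one_div_cancel hα0.ne', ENNReal.rpow_one,
    mul_one_div] at h
  rw [ENNReal.mul_rpow_of_nonneg _ _ hα0.le, mul_comm]
  refine h.trans (add_le_add ?_ ?_) <;>
  · refine ENNReal.div_le_of_le_mul (le_mul_of_one_le_right' ?_)
    rw [ENNReal.one_le_ofReal]
    rw [le_div_iff₀ (by assumption)]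
    linarith

lemma exists_rpow_le_mul_pow {θ : ℝ} (hθ : 1 < θ) (r : ℝ) :
    ∃ K : ℝ, 0 ≤ K ∧ ∀ n : ℕ, 1 ≤ n → (n : ℝ) ^ r ≤ K * θ ^ n := by
  obtain ⟨K, hK⟩ := (tendsto_pow_const_div_const_pow_of_one_lt ⌈r⌉₊ hθ).bddAbove_range
  have hK' : ∀ n : ℕ, (n : ℝ) ^ ⌈r⌉₊ / θ ^ n ≤ K := fun n => hK ⟨n, rfl⟩
  have hK0 : 0 ≤ K := le_trans (by positivity) (hK' 0)
  refine ⟨K, hK0, fun n hn => ?_⟩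
  have hn' : (1 : ℝ) ≤ n := by exact_mod_cast hn
  calc (n : ℝ) ^ r ≤ (n : ℝ) ^ (⌈r⌉₊ : ℝ) := Real.rpow_le_rpow_of_exponent_le hn' (Nat.le_ceil r)
    _ = (n : ℝ) ^ ⌈r⌉₊ := Real.rpow_natCast _ _
    _ ≤ K * θ ^ n := (div_le_iff₀ (by positivity)).1 (hK' n)

/-! ### Infinite mean in the subfair case -/

section Play

variable {Ω : Type*} [MeasurableSpace Ω] {μ : Measure Ω} {W : ℕ → Ω → Bool}
  [IsProbabilityMeasure μ] {p : ℝ}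

theorem lintegral_maxBet_eq_top_of_le_third (hp0 : 0 ≤ p) (hp : p ≤ 1 / 3)
    (hW : ∀ n, Measurable (W n)) (hind : iIndepFun W μ)
    (hWp : ∀ n, μ {ω | W n ω = true} = ENNReal.ofReal p)
    {L₀ : List ℝ} (hL₀ : L₀ ≠ []) (hpos : ∀ a ∈ L₀, 0 < a) :
    ∫⁻ ω, maxBet L₀ (fun n => W n ω) ∂μ = ∞ := by
  by_contra hfin
  obtain ⟨δ, hδ, hlen⟩ := exists_length_le hL₀ hpos
  set G : Ω → ℝ≥0∞ := fun ω => ENNReal.ofReal (1 / δ) * maxBet L₀ (fun n => W n ω) +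
    ENNReal.ofReal (L₀.length + 1) with hGdef
  have hGm : Measurable G := ((measurable_maxBet hW L₀).const_mul _).add_const _
  have hG : ∫⁻ ω, G ω ∂μ ≠ ∞ := by
    rw [hGdef, lintegral_add_right _ measurable_const,
      lintegral_const_mul _ (measurable_maxBet hW L₀)]
    simp only [lintegral_const, measure_univ, mul_one]
    exact ENNReal.add_ne_top.2 ⟨ENNReal.mul_ne_top ENNReal.ofReal_ne_top hfin,
      ENNReal.ofReal_ne_top⟩
  set V : List ℝ → ℝ := fun L => (L.length : ℝ) + (1 / 2) ^ L.length with hVdef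
  set c : List ℝ → ℝ := fun L => if L = [] then 0 else (1 / 2) ^ L.length / 2 with hcdef
  have hc0 : ∀ L, 0 ≤ c L := fun L => by simp only [hcdef]; split_ifs <;> positivity
  have hV0 : ∀ L, 0 ≤ V L := fun L => by simp only [hVdef]; positivity
  have hle : ∀ n ω, ENNReal.ofReal (V (list L₀ (fun i => W i ω) n)) ≤ G ω := by
    intro n ω
    have h1 := hlen (fun i => W i ω) n
    have h2 := betSize_le_maxBet L₀ (fun i => W i ω) n
    have h3 := betSize_nonneg (list_pos hpos (fun i => W i ω) n)
    refine le_trans ?_ (add_le_add_left (mul_le_mul_right h2 _) _)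
    rw [← ENNReal.ofReal_mul (by positivity), ← ENNReal.ofReal_add (by positivity) (by positivity)]
    apply ENNReal.ofReal_le_ofReal
    have h4 : ((1 : ℝ) / 2) ^ (list L₀ (fun i => W i ω) n).length ≤ 1 :=
      pow_le_one₀ (by norm_num) (by norm_num)
    have h5 : ((list L₀ (fun i => W i ω) n).length : ℝ) ≤
        L₀.length + 1 / δ * betSize (list L₀ (fun i => W i ω) n) := by
      refine le_of_mul_le_mul_left ?_ hδ
      rw [mul_add, ← mul_assoc, mul_one_div_cancel hδ.ne', one_mul]
      exact h1
    simp only [hVdef]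
    linarith
  have hsub := add_sum_lintegral_le_of_drift (by linarith) hp0 hW hind hWp hpos
    (V := V) (c := c) (fun L _ => hV0 L) (fun L _ => hc0 L) (fun L _ => length_drift hp L)
  have hmc := measurable_comp_list hW L₀ (fun L => ENNReal.ofReal (c L))
  have hsum : ∫⁻ ω, ∑' n, ENNReal.ofReal (c (list L₀ (fun i => W i ω) n)) ∂μ ≠ ∞ := by
    rw [lintegral_tsum fun n => (hmc n).aemeasurable]
    refine ne_top_of_le_ne_top hG (ENNReal.tsum_le_of_sum_range_le fun n => ?_)
    exact le_add_self.trans ((hsub n).trans (lintegral_mono (hle n)))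
  have hend : ∀ᵐ ω ∂μ, ∃ n, list L₀ (fun i => W i ω) n = [] := by
    filter_upwards [ae_lt_top (Measurable.tsum hmc) hsum, ae_lt_top hGm hG] with ω h1 h2
    -- If play never ended, the length would stay below the finite `G ω`, so the terms `c` would be
    -- bounded away from 0 and their sum infinite.
    by_contra! hne
    have hlow : ∀ n, ENNReal.ofReal ((1 / 2) ^ ⌈(G ω).toReal⌉₊ / 2) ≤
        ENNReal.ofReal (c (list L₀ (fun i => W i ω) n)) := by
      intro n
      apply ENNReal.ofReal_le_ofReal
      simp only [hcdef, if_neg (hne n)]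
      have h3 := (ENNReal.ofReal_le_iff_le_toReal h2.ne).1 (hle n ω)
      have h4 : (list L₀ (fun i => W i ω) n).length ≤ ⌈(G ω).toReal⌉₊ := by
        have h5 : ((list L₀ (fun i => W i ω) n).length : ℝ) ≤ (G ω).toReal := by
          refine le_trans ?_ h3
          simp only [hVdef]
          exact le_add_of_nonneg_right (by positivity)
        exact_mod_cast h5.trans (Nat.le_ceil _)
      have := pow_le_pow_of_le_one (by norm_num : (0 : ℝ) ≤ 1 / 2) (by norm_num) h4
      linarith
    refine h1.ne (top_unique ?_)
    refine le_trans (le_of_eq ?_) (ENNReal.tsum_le_tsum hlow)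
    refine (ENNReal.tsum_const_eq_top_of_ne_zero ?_).symm
    rw [ne_eq, ENNReal.ofReal_eq_zero, not_le]
    positivity
  have hfinal := le_of_dominated hW hG hle hend fun n => le_self_add.trans (hsub n)
  rw [ENNReal.ofReal_le_ofReal_iff (hV0 _)] at hfinal
  have h1 : (1 : ℝ) ≤ L₀.length := by exact_mod_cast List.length_pos_iff.2 hL₀
  have h2 : (0 : ℝ) < (1 / 2) ^ L₀.length := by positivity
  -- `V [] = 1`, whereas `V L₀ > 1` since `L₀` has at least one entry.
  simp only [hVdef, List.length_nil, pow_zero, Nat.cast_zero] at hfinal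
  linarith

theorem lintegral_maxBet_eq_top_of_third_lt (hp3 : 1 / 3 < p) (hp : p < 1 / 2)
    (hW : ∀ n, Measurable (W n)) (hind : iIndepFun W μ)
    (hWp : ∀ n, μ {ω | W n ω = true} = ENNReal.ofReal p)
    {L₀ : List ℝ} (hL₀ : L₀ ≠ []) (hpos : ∀ a ∈ L₀, 0 < a) :
    ∫⁻ ω, maxBet L₀ (fun n => W n ω) ∂μ = ∞ := by
  by_contra hfin
  have hp0 : 0 ≤ p := by linarith
  have hp1 : p ≤ 1 := by linarith
  obtain ⟨θ, ε, hθ, hε, hdrift⟩ := exists_exponential_base hp3 (by linarith)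
  obtain ⟨α, hα0, hα1, hα⟩ := exists_rpow_exponent (q := 1 - p) (by linarith) (by linarith)
  obtain ⟨K, hK0, hK⟩ := exists_rpow_le_mul_pow hθ (α / (1 - α))
  set E : List ℝ → ℝ := fun L => if L = [] then 0 else θ ^ L.length with hEdef
  have hE0 : ∀ L, 0 ≤ E L := fun L => by simp only [hEdef]; split_ifs <;> positivity
  have hmE := measurable_comp_list hW L₀ (fun L => ENNReal.ofReal (ε * E L))
  have hmsum : Measurable fun ω => ∑' n, ENNReal.ofReal (ε * E (list L₀ (fun i => W i ω) n)) :=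
    Measurable.tsum hmE
  have hsum : ∫⁻ ω, ∑' n, ENNReal.ofReal (ε * E (list L₀ (fun i => W i ω) n)) ∂μ ≠ ∞ :=
    ne_top_of_le_ne_top ENNReal.ofReal_ne_top <|
      tsum_lintegral_le_of_drift hp1 hp0 hW hind hWp hpos (V := E) (c := fun L => ε * E L)
        (fun L _ => hE0 L) (fun L _ => mul_nonneg hε.le (hE0 L))
        (fun L _ => exponential_drift hp0 hθ hdrift L)
  have hend : ∀ᵐ ω ∂μ, ∃ n, list L₀ (fun i => W i ω) n = [] := by
    filter_upwards [ae_lt_top hmsum hsum] with ω h1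
    by_contra! hne
    -- While play lasts each term is at least `ε`, so the sum would diverge.
    have hlow : ∀ n, ENNReal.ofReal ε ≤
        ENNReal.ofReal (ε * E (list L₀ (fun i => W i ω) n)) := by
      intro n
      apply ENNReal.ofReal_le_ofReal
      simp only [hEdef, if_neg (hne n)]
      exact le_mul_of_one_le_right hε.le (one_le_pow₀ hθ.le)
    refine h1.ne (top_unique ?_)
    refine le_trans (le_of_eq ?_) (ENNReal.tsum_le_tsum hlow)
    refine (ENNReal.tsum_const_eq_top_of_ne_zero ?_).symm
    rwa [ne_eq, ENNReal.ofReal_eq_zero, not_le]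
  set G : Ω → ℝ≥0∞ := fun ω => (maxBet L₀ (fun n => W n ω) + ENNReal.ofReal L₀.sum) +
    ENNReal.ofReal (K / ε) * ∑' n, ENNReal.ofReal (ε * E (list L₀ (fun i => W i ω) n)) with hGdef
  have hG : ∫⁻ ω, G ω ∂μ ≠ ∞ := by
    rw [hGdef, lintegral_add_right _ (hmsum.const_mul _), lintegral_add_right _ measurable_const,
      lintegral_const_mul _ hmsum]
    simp only [lintegral_const, measure_univ, mul_one]
    exact ENNReal.add_ne_top.2 ⟨ENNReal.add_ne_top.2 ⟨hfin, ENNReal.ofReal_ne_top⟩,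
      ENNReal.mul_ne_top ENNReal.ofReal_ne_top hsum⟩
  have hle : ∀ n ω, ENNReal.ofReal ((list L₀ (fun i => W i ω) n).sum ^ α) ≤ G ω := by
    intro n ω
    have hM := mem_list_le L₀ hpos (fun i => W i ω) n
    have hterm := ENNReal.le_tsum
      (f := fun n => ENNReal.ofReal (ε * E (list L₀ (fun i => W i ω) n))) n
    have hLpos := list_pos hpos (fun i => W i ω) n
    simp only [hGdef]
    generalize (∑' n, ENNReal.ofReal (ε * E (list L₀ (fun i => W i ω) n))) = T at *
    generalize list L₀ (fun i => W i ω) n = L at *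
    rcases eq_or_ne L [] with rfl | hne
    · simp [Real.zero_rpow hα0.ne']
    rw [← ENNReal.ofReal_rpow_of_nonneg (sum_nonneg_of_pos hLpos) hα0.le]
    refine (ENNReal.rpow_le_rpow (ofReal_sum_le_length_mul hM) hα0.le).trans ?_
    refine (mul_rpow_le_add hα0 hα1 _ _).trans ?_
    gcongr
    refine le_trans ?_ (mul_le_mul_right hterm _)
    rw [← ENNReal.ofReal_mul (by positivity), ← ENNReal.ofReal_natCast,
      ENNReal.ofReal_rpow_of_nonneg (by positivity) (div_nonneg hα0.le (by linarith))]
    apply ENNReal.ofReal_le_ofReal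
    refine (hK _ (List.length_pos_iff.2 hne)).trans (le_of_eq ?_)
    simp only [hEdef, if_neg hne]
    field_simp
  have hsub := add_sum_lintegral_le_of_drift hp1 hp0 hW hind hWp hpos
    (V := fun L => L.sum ^ α) (c := fun _ => 0)
    (fun L hL => Real.rpow_nonneg (sum_nonneg_of_pos hL) _) (fun _ _ => le_rfl) (fun L hL => by
      rw [sum_step_true, sum_step_false, add_zero]
      exact rpow_le_mean_rpow hp0 hp1 hα0 hα1 hα (betSize_nonneg hL) (betSize_le_sum hL))
  have hfinal := le_of_dominated hW (V := fun L => L.sum ^ α) hG hle hend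
    fun n => le_self_add.trans (hsub n)
  simp only [List.sum_nil, Real.zero_rpow hα0.ne', ENNReal.ofReal_zero, nonpos_iff_eq_zero,
    ENNReal.ofReal_eq_zero] at hfinal
  exact absurd hfinal (not_le.2 (Real.rpow_pos_of_pos (List.sum_pos _ hpos hL₀) _))

end Play

end Labouchere

theorem corollary1 {Ω : Type*} [MeasurableSpace Ω] (μ : Measure Ω) [IsProbabilityMeasure μ]
    (p : ℝ) (hp : p ∈ Set.Icc (0 : ℝ) 1)
    (W : ℕ → Ω → Bool) (hWmeas : ∀ n, Measurable (W n)) (hWindep : iIndepFun W μ)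
    (hWp : ∀ n, μ {ω | W n ω = true} = ENNReal.ofReal p)
    (L₀ : List ℝ) (hL₀ : L₀ ≠ []) (hpos : ∀ a ∈ L₀, 0 < a) :
    (1 / 2 < p → ∫⁻ ω, Labouchere.maxBet L₀ (fun n => W n ω) ∂μ < ∞) ∧
    (p < 1 / 2 → ∫⁻ ω, Labouchere.maxBet L₀ (fun n => W n ω) ∂μ = ∞) := by
  refine ⟨fun h => Labouchere.lintegral_maxBet_lt_top hp.2 h hWmeas hWindep hWp hpos, fun h => ?_⟩
  rcases le_or_gt p (1 / 3) with h3 | h3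
  · exact Labouchere.lintegral_maxBet_eq_top_of_le_third hp.1 h3 hWmeas hWindep hWp hL₀ hpos
  · exact Labouchere.lintegral_maxBet_eq_top_of_third_lt h3 h hWmeas hWindep hWp hL₀ hpos
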